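/- Let $G$ be an abelian group (with no topology) and let $\mathbf{A}=(A,\mu,\alpha)$ be a system: $A$ is a von Neumann algebra acting on a complex Hilbert space, $\mu$ is a faithful normal state on $A$, and $\alpha:G\to\mathrm{Aut}(A)$, $g\mapsto\alpha_g$, is a homomorphism into the group of $*$-automorphisms of $A$ with $\mu\circ\alpha_g=\mu$ for all $g\in G$. Let $H_\mu$ be the GNS Hilbert space of $(A,\mu)$, with canonical map $\gamma_\mu:A\to H_\mu$, $\langle\gamma_\mu(a),\gamma_\mu(b)\rangle=\mu(a^*b)$, and let $U_g$ be the unitary operator on $H_\mu$ determined by $U_g\gamma_\mu(a)=\gamma_\mu(\alpha_g(a))$ for all $a\in A$. An eigenvector of $U$ is a nonzero $x\in H_\mu$ for which there is a function $\chi:G\to\mathbb{C}$ with $U_gx=\chi(g)x$ for all $g\in G$; let $H_0$ be the closed linear span of the eigenvectors of $U$. The system $\mathbf{A}$ is weakly mixing if $\dim H_0=1$. An eigenoperator of $\alpha$ is a nonzero $u\in A$ for which there is a function $\chi:G\to\mathbb{C}$ with $\alpha_g(u)=\chi(g)u$ for all $g\in G$. Let $A^K$ be the von Neumann subalgebra of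 $A$ generated by the eigenoperators of $\alpha$; it satisfies $\alpha_g(A^K)=A^K$ for all $g\in G$, and the compact subsystem of $\mathbf{A}$ is $\mathbf{A}^K=(A^K,\mu|_{A^K},\alpha|_{A^K})$. A system is trivial if its algebra is $\mathbb{C}1$. Then $\mathbf{A}$ is weakly mixing if and only if $\mathbf{A}^K$ is trivial. -/

import Mathlib

set_option linter.unusedSectionVars false

open scoped InnerProductSpace ComplexOrder

namespace VonNeumannAlgebra

variable {H : Type*} [NormedAddCommGroup H] [InnerProductSpace ℂ H] [CompleteSpace H]

instance instSMulMemClass : SMulMemClass (VonNeumannAlgebra H) ℂ (H →L[ℂ] H) where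
  smul_mem {M} c a ha := show c • a ∈ M.toStarSubalgebra from M.toStarSubalgebra.smul_mem ha c

instance instIsClosed (M : VonNeumannAlgebra H) : IsClosed (M : Set (H →L[ℂ] H)) := by
  rw [← M.centralizer_centralizer]
  exact Set.isClosed_centralizer _

/-- With the order inherited from the operators on `H` (the order `0 ≤ a` iff `a` is a positive
operator), a von Neumann algebra is a star-ordered ring: its positive elements are the sums of
elements `star b * b` with `b` in the algebra. -/
instance instStarOrderedRing (M : VonNeumannAlgebra H) : StarOrderedRing M where
  le_iff x y := by
    constructor
    · intro h
      have h' : (0 : H →L[ℂ] H) ≤ ((y - x : M) : H →L[ℂ] H) := by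
        have h2 : (x : H →L[ℂ] H) ≤ y := h
        simpa using h2
      have hsa : IsSelfAdjoint (y - x) := Subtype.ext (IsSelfAdjoint.of_nonneg h')
      have hsp : SpectrumRestricts (y - x) ContinuousMap.realToNNReal := by
        rw [SpectrumRestricts.nnreal_iff]
        intro r hr
        have hr2 : (r : ℂ) ∈ spectrum ℂ (y - x) := by
          rw [← spectrum.algebraMap_mem_iff ℂ] at hr
          exact hr
        have hr3 : (r : ℂ) ∈ spectrum ℂ ((y - x : M) : H →L[ℂ] H) := by
          have := StarSubalgebra.spectrum_eq (S := M.toStarSubalgebra)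
            (hS := M.instIsClosed) (a := y - x)
          exact this ▸ hr2
        have hr4 : r ∈ spectrum ℝ ((y - x : M) : H →L[ℂ] H) := by
          rw [← spectrum.algebraMap_mem_iff ℂ]
          exact hr3
        exact spectrum_nonneg_of_nonneg h' hr4
      obtain ⟨s, hs₁, _, hs₂⟩ :=
        CFC.exists_sqrt_of_isSelfAdjoint_of_quasispectrumRestricts hsa
          (quasispectrumRestricts_iff_spectrumRestricts.mpr hsp)
      refine ⟨s * s, AddSubmonoid.subset_closure ⟨s, by simp [hs₁.star_eq]⟩, ?_⟩
      rwa [eq_sub_iff_add_eq', eq_comm] at hs₂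
    · rintro ⟨p, hp, rfl⟩
      suffices h : (0 : H →L[ℂ] H) ≤ (p : H →L[ℂ] H) by
        change (x : H →L[ℂ] H) ≤ (x : H →L[ℂ] H) + (p : H →L[ℂ] H)
        exact le_add_of_nonneg_right h
      induction hp using AddSubmonoid.closure_induction with
      | mem _ hs =>
        obtain ⟨s, rfl⟩ := hs
        exact star_mul_self_nonneg (s : H →L[ℂ] H)
      | zero => exact le_rfl
      | add a b _ _ ha hb => exact add_nonneg ha hb

/-- The von Neumann algebra generated by a set `s` of bounded operators: the double commutant of
`s ∪ star s`. -/
noncomputable def generatedBy (s : Set (H →L[ℂ] H)) : VonNeumannAlgebra H where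
  toStarSubalgebra := StarSubalgebra.centralizer ℂ (StarSubalgebra.centralizer ℂ s)
  centralizer_centralizer' := by
    change Set.centralizer (Set.centralizer
      ((StarSubalgebra.centralizer ℂ (StarSubalgebra.centralizer ℂ s : Set (H →L[ℂ] H)) :
        StarSubalgebra ℂ (H →L[ℂ] H)) : Set (H →L[ℂ] H))) =
      ((StarSubalgebra.centralizer ℂ (StarSubalgebra.centralizer ℂ s : Set (H →L[ℂ] H)) :
        StarSubalgebra ℂ (H →L[ℂ] H)) : Set (H →L[ℂ] H))
    rw [StarSubalgebra.coe_centralizer_centralizer, Set.centralizer_centralizer_centralizer]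

theorem coe_generatedBy (s : Set (H →L[ℂ] H)) :
    (generatedBy s : Set (H →L[ℂ] H)) = (s ∪ star s).centralizer.centralizer :=
  StarSubalgebra.coe_centralizer_centralizer ℂ s

theorem subset_generatedBy (s : Set (H →L[ℂ] H)) : s ⊆ generatedBy s := by
  rw [coe_generatedBy]
  exact Set.subset_union_left.trans Set.subset_centralizer_centralizer

/-- `generatedBy s` is the least von Neumann algebra that contains `s`. -/
theorem generatedBy_le {s : Set (H →L[ℂ] H)} {M : VonNeumannAlgebra H}
    (h : s ⊆ M) : generatedBy s ≤ M := by
  have h' : s ∪ star s ⊆ (M : Set (H →L[ℂ] H)) := by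
    rintro a (ha | ha)
    · exact h ha
    · simpa using star_mem (h ha)
  change (generatedBy s : Set (H →L[ℂ] H)) ⊆ M
  rw [coe_generatedBy, ← M.centralizer_centralizer]
  exact Set.centralizer_subset (Set.centralizer_subset h')

/-- A linear functional on a von Neumann algebra is normal if it is `σ`-weakly continuous, i.e. if
it belongs to the predual: `φ a = ∑ₙ ⟪ξₙ, a ηₙ⟫` for square-summable sequences of vectors. -/
def IsNormal {M : VonNeumannAlgebra H} (φ : M → ℂ) : Prop :=
  ∃ ξ η : ℕ → H, Summable (fun n => ‖ξ n‖ ^ 2) ∧ Summable (fun n => ‖η n‖ ^ 2) ∧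
    ∀ a : M, HasSum (fun n => ⟪ξ n, (a : H →L[ℂ] H) (η n)⟫_ℂ) (φ a)

end VonNeumannAlgebra

/-- A (W*-dynamical) system: a faithful normal state on a von Neumann algebra together with an
action of the group `G` by state-preserving `*`-automorphisms. -/
structure WStarSystem (G : Type*) [Group G] (H : Type*) [NormedAddCommGroup H]
    [InnerProductSpace ℂ H] [CompleteSpace H] where
  algebra : VonNeumannAlgebra H
  state : algebra →ₚ[ℂ] ℂ
  state_one : state 1 = 1
  faithful : ∀ a : algebra, state (star a * a) = 0 → a = 0
  normal : VonNeumannAlgebra.IsNormal state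
  action : G →* (algebra ≃⋆ₐ[ℂ] algebra)
  state_action : ∀ (g : G) (a : algebra), state (action g a) = state a

namespace WStarSystem

variable {G : Type*} [Group G] {H : Type*} [NormedAddCommGroup H] [InnerProductSpace ℂ H]
  [CompleteSpace H] (A : WStarSystem G H)

/-- The GNS Hilbert space `H_μ` of the state of the system. -/
abbrev gnsSpace : Type _ := A.state.GNS

/-- The canonical map `γ_μ : A → H_μ`, `a ↦ π_μ(a) Ω_μ`. -/
noncomputable def gamma (a : A.algebra) : A.gnsSpace :=
  ((A.state.toPreGNS a : A.state.PreGNS) : A.state.GNS)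

/-- The operator `γ_μ(a) ↦ γ_μ(α_g(a))` on the dense image of the algebra. -/
noncomputable def preU (g : G) : A.state.PreGNS →ₗᵢ[ℂ] A.state.PreGNS where
  toLinearMap := A.state.toPreGNS.toLinearMap ∘ₗ
    (A.action g).toAlgEquiv.toLinearMap ∘ₗ A.state.ofPreGNS.toLinearMap
  norm_map' x := by
    simp [PositiveLinearMap.preGNS_norm_def, ← map_star, ← map_mul, A.state_action]

/-- The unitary group `U` on `H_μ` representing the dynamics, determined by
`U_g γ_μ(a) = γ_μ(α_g(a))`. -/
noncomputable def U (g : G) : A.gnsSpace →L[ℂ] A.gnsSpace :=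
  (A.preU g).toContinuousLinearMap.completion

theorem U_gamma (g : G) (a : A.algebra) :
    A.U g (A.gamma a) = A.gamma (A.action g a) := by
  simp [U, gamma, preU]

/-- An eigenvector of `U`. -/
def IsEigenvector (x : A.gnsSpace) : Prop :=
  x ≠ 0 ∧ ∃ χ : G → ℂ, ∀ g, A.U g x = χ g • x

/-- The Hilbert subspace `H₀` of `H_μ` spanned by the eigenvectors of `U`. -/
noncomputable def H₀ : Submodule ℂ A.gnsSpace :=
  (Submodule.span ℂ {x | A.IsEigenvector x}).topologicalClosure

/-- A system is weakly mixing if `dim H₀ = 1`. -/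
def IsWeaklyMixing : Prop := Module.rank ℂ A.H₀ = 1

/-- A system is trivial if its algebra is `ℂ 1`. -/
def IsTrivial : Prop := ∀ a : A.algebra, ∃ c : ℂ, a = c • 1

/-- An eigenoperator of `α`. -/
def IsEigenoperator (u : A.algebra) : Prop :=
  u ≠ 0 ∧ ∃ χ : G → ℂ, ∀ g, A.action g u = χ g • u

/-- The von Neumann algebra `A^K` generated by the eigenoperators of `α`. -/
noncomputable def compactAlgebra : VonNeumannAlgebra H :=
  VonNeumannAlgebra.generatedBy {a | ∃ u : A.algebra, A.IsEigenoperator u ∧ (u : H →L[ℂ] H) = a}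

theorem compactAlgebra_le : A.compactAlgebra ≤ A.algebra :=
  VonNeumannAlgebra.generatedBy_le (by rintro _ ⟨u, -, rfl⟩; exact u.2)

end WStarSystem

namespace VonNeumannAlgebra

variable {H : Type*} [NormedAddCommGroup H] [InnerProductSpace ℂ H] [CompleteSpace H]

/-- The diagonal action of an operator on square-summable families of vectors. -/
noncomputable def amp (ι : Type*) (a : H →L[ℂ] H) :
    lp (fun _ : ι => H) 2 →L[ℂ] lp (fun _ : ι => H) 2 :=
  lp.mapCLM 2 (fun _ => a) (norm_nonneg a) (fun _ => le_rfl)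

section amp

variable {ι : Type*}

@[simp]
theorem amp_apply (a : H →L[ℂ] H) (x : lp (fun _ : ι => H) 2) (i : ι) :
    (amp ι a x : ι → H) i = a (x i) := rfl

theorem amp_mul (a b : H →L[ℂ] H) (x : lp (fun _ : ι => H) 2) :
    amp ι (a * b) x = amp ι a (amp ι b x) := rfl

theorem amp_one (x : lp (fun _ : ι => H) 2) : amp ι (1 : H →L[ℂ] H) x = x := rfl

theorem amp_add (a b : H →L[ℂ] H) (x : lp (fun _ : ι => H) 2) :
    amp ι (a + b) x = amp ι a x + amp ι b x := by
  ext i; simp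

theorem amp_sub (a b : H →L[ℂ] H) (x : lp (fun _ : ι => H) 2) :
    amp ι (a - b) x = amp ι a x - amp ι b x := by
  ext i; simp

theorem amp_smul (c : ℂ) (a : H →L[ℂ] H) (x : lp (fun _ : ι => H) 2) :
    amp ι (c • a) x = c • amp ι a x := by
  ext i; simp

theorem amp_inner (a : H →L[ℂ] H) (x y : lp (fun _ : ι => H) 2) :
    ⟪amp ι a x, y⟫_ℂ = ⟪x, amp ι (star a) y⟫_ℂ := by
  rw [lp.inner_eq_tsum, lp.inner_eq_tsum]
  congr 1; ext i
  simp [ContinuousLinearMap.star_eq_adjoint, ContinuousLinearMap.adjoint_inner_right]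

/-- The vectors `s x`, `s` in a star subalgebra. -/
noncomputable def orbit (S : StarSubalgebra ℂ (H →L[ℂ] H)) (x : lp (fun _ : ι => H) 2) :
    Submodule ℂ (lp (fun _ : ι => H) 2) where
  carrier := {y | ∃ s ∈ S, amp ι s x = y}
  add_mem' := by
    rintro _ _ ⟨s, hs, rfl⟩ ⟨t, ht, rfl⟩
    exact ⟨s + t, add_mem hs ht, amp_add _ _ _⟩
  zero_mem' := ⟨0, zero_mem _, by ext i; simp⟩
  smul_mem' := by
    rintro c _ ⟨s, hs, rfl⟩
    exact ⟨c • s, SMulMemClass.smul_mem c hs, amp_smul _ _ _⟩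

theorem orbit_closure_invariant (S : StarSubalgebra ℂ (H →L[ℂ] H)) (x : lp (fun _ : ι => H) 2)
    {s : H →L[ℂ] H} (hs : s ∈ S) {y : lp (fun _ : ι => H) 2}
    (hy : y ∈ (orbit S x).topologicalClosure) : amp ι s y ∈ (orbit S x).topologicalClosure := by
  have : Set.MapsTo (amp ι s) (orbit S x) (orbit S x) := by
    rintro _ ⟨t, ht, rfl⟩
    exact ⟨s * t, mul_mem hs ht, rfl⟩
  exact this.closure (amp ι s).continuous hy

/-- If a closed subspace is invariant under an operator and its adjoint, the projection onto it
commutes with the operator. -/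
theorem starProjection_comm {E : Type*} [NormedAddCommGroup E] [InnerProductSpace ℂ E]
    (V : Submodule ℂ E) [V.HasOrthogonalProjection] (T T' : E →L[ℂ] E)
    (hadj : ∀ x y, ⟪T x, y⟫_ℂ = ⟪x, T' y⟫_ℂ)
    (h : ∀ x ∈ V, T x ∈ V) (h' : ∀ x ∈ V, T' x ∈ V) (x : E) :
    V.starProjection (T x) = T (V.starProjection x) := by
  refine Submodule.eq_starProjection_of_mem_of_inner_eq_zero
    (h _ (Submodule.starProjection_apply_mem _ _)) ?_ |>.symm ▸ rfl
  intro w hw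
  rw [← map_sub, hadj]
  exact Submodule.starProjection_inner_eq_zero x _ (h' _ hw)

/-- An operator in the double commutant of `S` maps every vector of the amplification into the
closure of its orbit under `S`. -/
theorem amp_mem_closure (S : StarSubalgebra ℂ (H →L[ℂ] H)) {a : H →L[ℂ] H}
    (ha : a ∈ (S : Set (H →L[ℂ] H)).centralizer.centralizer) (x : lp (fun _ : ι => H) 2) :
    amp ι a x ∈ (orbit S x).topologicalClosure := by
  classical
  set V := (orbit S x).topologicalClosure with hV
  have : CompleteSpace V := (orbit S x).isClosed_topologicalClosure.completeSpace_coe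
  have hx : x ∈ V := Submodule.le_topologicalClosure _ ⟨1, one_mem S, amp_one x⟩
  have hS : ∀ s ∈ S, ∀ y, V.starProjection (amp ι s y) = amp ι s (V.starProjection y) :=
    fun s hs y => starProjection_comm V (amp ι s) (amp ι (star s)) (amp_inner s)
      (fun z hz => orbit_closure_invariant S x hs hz)
      (fun z hz => orbit_closure_invariant S x (star_mem hs) hz) y
  have hsingle : ∀ (b : H →L[ℂ] H) (j : ι) (h : H),
      amp ι b (lp.single 2 j h) = lp.single 2 j (b h) := by
    intro b j h
    ext i
    by_cases hij : i = j
    · subst hij; simp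
    · simp [hij]
  let Tm : ι → ι → (H →L[ℂ] H) := fun i j =>
    (lp.evalCLM ℂ (fun _ : ι => H) 2 i) ∘L V.starProjection ∘L
      (lp.singleContinuousLinearMap ℂ (fun _ : ι => H) 2 j)
  have hTm : ∀ i j h, Tm i j h = (V.starProjection (lp.single 2 j h) : ι → H) i :=
    fun _ _ _ => rfl
  have hcomm : ∀ i j, Tm i j ∈ (S : Set (H →L[ℂ] H)).centralizer := by
    intro i j s hs
    ext h
    simp only [mul_apply_eq_comp, hTm]
    rw [← hsingle, hS s hs]; rfl
  have key : (amp ι a) ∘L V.starProjection = V.starProjection ∘L (amp ι a) := by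
    apply lp.ext_continuousLinearMap (by norm_num)
    intro j
    ext h i
    have := DFunLike.congr_fun (ha _ (hcomm i j)) h
    simp only [mul_apply_eq_comp, hTm] at this
    simp only [ContinuousLinearMap.comp_apply, lp.singleContinuousLinearMap_apply, amp_apply,
      hsingle]
    exact this.symm
  have h2 := DFunLike.congr_fun key x
  simp only [ContinuousLinearMap.comp_apply] at h2
  rw [Submodule.starProjection_eq_self_iff.mpr hx] at h2
  rw [h2]
  exact Submodule.starProjection_apply_mem _ _

end amp

end VonNeumannAlgebra

namespace VonNeumannAlgebra

variable {H : Type*} [NormedAddCommGroup H] [InnerProductSpace ℂ H] [CompleteSpace H]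

section pair

variable {ι : Type*}

/-- Two square-summable families, combined into one. -/
noncomputable def pair (x y : lp (fun _ : ι => H) 2) : lp (fun _ : ι ⊕ ι => H) 2 :=
  ⟨fun i => Sum.elim (x : ι → H) (y : ι → H) i, by
    have hx := (memℓp_gen_iff (p := 2) (by norm_num)).mp (lp.memℓp x)
    have hy := (memℓp_gen_iff (p := 2) (by norm_num)).mp (lp.memℓp y)
    exact (memℓp_gen_iff (p := 2) (by norm_num)).mpr
      (Summable.sum (fun i : ι ⊕ ι => ‖Sum.elim (x : ι → H) (y : ι → H) i‖ ^ (2 : ENNReal).toReal)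
        hx hy)⟩

theorem amp_pair (a : H →L[ℂ] H) (x y : lp (fun _ : ι => H) 2) :
    amp (ι ⊕ ι) a (pair x y) = pair (amp ι a x) (amp ι a y) := by
  ext i; cases i <;> rfl

theorem inner_pair (x y x' y' : lp (fun _ : ι => H) 2) :
    ⟪pair x y, pair x' y'⟫_ℂ = ⟪x, x'⟫_ℂ + ⟪y, y'⟫_ℂ :=
  HasSum.unique (lp.hasSum_inner _ _)
    (HasSum.sum (f := fun i => ⟪(pair x y : ι ⊕ ι → H) i, (pair x' y' : ι ⊕ ι → H) i⟫_ℂ)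
      (lp.hasSum_inner x x') (lp.hasSum_inner y y'))

theorem norm_sq_pair (x y : lp (fun _ : ι => H) 2) :
    ‖pair x y‖ ^ 2 = ‖x‖ ^ 2 + ‖y‖ ^ 2 := by
  have h := inner_pair x y x y
  simp only [inner_self_eq_norm_sq_to_K] at h
  exact_mod_cast h

/-- If a functional `∑ ⟪ξᵢ, s ηᵢ⟫` vanishes on `S`, it vanishes on the double commutant. -/
theorem inner_amp_eq_zero (S : StarSubalgebra ℂ (H →L[ℂ] H)) {a : H →L[ℂ] H}
    (ha : a ∈ (S : Set (H →L[ℂ] H)).centralizer.centralizer) (x z : lp (fun _ : ι => H) 2)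
    (h : ∀ s ∈ S, ⟪z, amp ι s x⟫_ℂ = 0) : ⟪z, amp ι a x⟫_ℂ = 0 := by
  have hcl : IsClosed {y : lp (fun _ : ι => H) 2 | ⟪z, y⟫_ℂ = 0} :=
    isClosed_eq (by fun_prop) continuous_const
  refine closure_minimal ?_ hcl (amp_mem_closure S ha x)
  rintro _ ⟨s, hs, rfl⟩
  exact h s hs

/-- A self-adjoint operator in the double commutant of `S` is approximated, at any vector of the
amplification, by self-adjoint elements of `S`. -/
theorem exists_selfAdjoint_approx (S : StarSubalgebra ℂ (H →L[ℂ] H)) {a : H →L[ℂ] H}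
    (ha : a ∈ (S : Set (H →L[ℂ] H)).centralizer.centralizer) (hsa : star a = a)
    (x : lp (fun _ : ι => H) 2) {ε : ℝ} (hε : 0 < ε) :
    ∃ s ∈ S, star s = s ∧ ‖amp ι (s - a) x‖ < ε := by
  set C : Set (lp (fun _ : ι => H) 2) := {y | ∃ s ∈ S, star s = s ∧ amp ι s x = y} with hC
  have hreal : ∀ (t : ℝ) (s : H →L[ℂ] H), star s = s → star ((t : ℂ) • s) = (t : ℂ) • s := by
    intro t s hs
    rw [star_smul, hs]
    simp
  have hconv : Convex ℝ C := by
    rintro _ ⟨s, hs, hs', rfl⟩ _ ⟨t, ht, ht', rfl⟩ p q hp hq hpq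
    refine ⟨(p : ℂ) • s + (q : ℂ) • t,
      add_mem (SMulMemClass.smul_mem _ hs) (SMulMemClass.smul_mem _ ht), ?_, ?_⟩
    · rw [star_add, hreal _ _ hs', hreal _ _ ht']
    · rw [amp_add, amp_smul, amp_smul]; rfl
  suffices hmem : amp ι a x ∈ closure C by
    obtain ⟨_, ⟨s, hs, hs', rfl⟩, hd⟩ := Metric.mem_closure_iff.mp hmem ε hε
    refine ⟨s, hs, hs', ?_⟩
    rwa [amp_sub, ← dist_eq_norm, dist_comm]
  by_contra hmem
  obtain ⟨f, u, hfu, hf⟩ := RCLike.geometric_hahn_banach_point_closed (𝕜 := ℂ)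
    hconv.closure isClosed_closure hmem
  obtain ⟨z, rfl⟩ := (InnerProductSpace.toDual ℂ (lp (fun _ : ι => H) 2)).surjective f
  simp only [InnerProductSpace.toDual_apply_apply] at hfu hf
  have hu : u < 0 := by
    have := hf 0 (subset_closure ⟨0, zero_mem S, by simp, by ext i; simp⟩)
    simpa using this
  have hzero : ∀ s ∈ S, star s = s → (⟪z, amp ι s x⟫_ℂ).re = 0 := by
    intro s hs hs'
    by_contra hne
    set r := (⟪z, amp ι s x⟫_ℂ).re with hr
    have := hf _ (subset_closure ⟨((u / r : ℝ) : ℂ) • s, SMulMemClass.smul_mem _ hs,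
      hreal _ _ hs', rfl⟩)
    rw [amp_smul, inner_smul_right, RCLike.re_eq_complex_re, Complex.re_ofReal_mul, ← hr,
      div_mul_cancel₀ _ hne] at this
    exact lt_irrefl _ this
  have hsum : ∀ s : H →L[ℂ] H, star s = s →
      ⟪pair z x, amp (ι ⊕ ι) s (pair x z)⟫_ℂ = ((2 * (⟪z, amp ι s x⟫_ℂ).re : ℝ) : ℂ) := by
    intro s hs
    rw [amp_pair, inner_pair]
    have h1 : ⟪x, amp ι s z⟫_ℂ = (starRingEnd ℂ) ⟪z, amp ι s x⟫_ℂ := by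
      rw [inner_conj_symm, amp_inner, hs]
    rw [h1, Complex.add_conj]
  have hvan : ∀ s ∈ S, ⟪pair z x, amp (ι ⊕ ι) s (pair x z)⟫_ℂ = 0 := by
    intro s hs
    have hp : star (s + star s) = s + star s := by rw [star_add, star_star, add_comm]
    have hq : star (Complex.I • (s - star s)) = Complex.I • (s - star s) := by
      rw [star_smul, star_sub, star_star]
      simp only [RCLike.star_def, Complex.conj_I]
      module
    have h1 := hsum _ hp
    have h2 := hsum _ hq
    rw [hzero _ (add_mem hs (star_mem hs)) hp] at h1
    rw [hzero _ (SMulMemClass.smul_mem _ (sub_mem hs (star_mem hs))) hq] at h2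
    rw [amp_smul, inner_smul_right] at h2
    rw [amp_add, inner_add_right] at h1
    rw [amp_sub, inner_sub_right] at h2
    simp only [mul_zero, Complex.ofReal_zero, mul_eq_zero, Complex.I_ne_zero, false_or] at h1 h2
    linear_combination (1 / 2 : ℂ) * h1 + (1 / 2 : ℂ) * h2
  have hfin := inner_amp_eq_zero S ha (pair x z) (pair z x) hvan
  rw [hsum a hsa] at hfin
  have : (⟪z, amp ι a x⟫_ℂ).re = 0 := by
    have := Complex.ofReal_eq_zero.mp hfin
    linarith
  rw [RCLike.re_eq_complex_re, this] at hfu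
  exact lt_asymm hu hfu

end pair

section state

variable {M : VonNeumannAlgebra H} (φ : M →ₚ[ℂ] ℂ)

theorem norm_apply_le_gns (a b : M) :
    ‖φ (star a * b)‖ ≤ ‖φ.toPreGNS a‖ * ‖φ.toPreGNS b‖ :=
  norm_inner_le_norm (𝕜 := ℂ) (φ.toPreGNS a) (φ.toPreGNS b)

theorem gns_norm_sq (a : M) : ((‖φ.toPreGNS a‖ ^ 2 : ℝ) : ℂ) = φ (star a * a) := by
  simpa using φ.preGNS_norm_sq (φ.toPreGNS a)

/-- A normal positive functional is dominated by a vector functional of the amplification. -/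
theorem exists_dominating (hn : IsNormal φ) :
    ∃ x : lp (fun _ : ℕ ⊕ ℕ => H) 2, ∀ a : M,
      ‖φ.toPreGNS a‖ ≤ ‖amp (ℕ ⊕ ℕ) (a : H →L[ℂ] H) x‖ := by
  obtain ⟨ξ, η, hξ, hη, hφ⟩ := hn
  let ξ' : lp (fun _ : ℕ => H) 2 :=
    ⟨ξ, (memℓp_gen_iff (p := 2) (by norm_num)).mpr (by simpa using hξ)⟩
  let η' : lp (fun _ : ℕ => H) 2 :=
    ⟨η, (memℓp_gen_iff (p := 2) (by norm_num)).mpr (by simpa using hη)⟩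
  have hφ' : ∀ a : M, φ a = ⟪ξ', amp ℕ (a : H →L[ℂ] H) η'⟫_ℂ := fun a =>
    (hφ a).unique (lp.hasSum_inner ξ' (amp ℕ (a : H →L[ℂ] H) η'))
  refine ⟨pair ξ' η', fun a => ?_⟩
  refine le_of_sq_le_sq ?_ (norm_nonneg _)
  rw [amp_pair, norm_sq_pair]
  have h1 : φ (star a * a) = ⟪amp ℕ (a : H →L[ℂ] H) ξ', amp ℕ (a : H →L[ℂ] H) η'⟫_ℂ := by
    rw [hφ', amp_inner]; rfl
  have h2 : ‖φ.toPreGNS a‖ ^ 2 =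
      ‖⟪amp ℕ (a : H →L[ℂ] H) ξ', amp ℕ (a : H →L[ℂ] H) η'⟫_ℂ‖ := by
    rw [← h1, ← gns_norm_sq, Complex.norm_real, Real.norm_of_nonneg (sq_nonneg _)]
  rw [h2]
  refine (norm_inner_le_norm _ _).trans ?_
  nlinarith [sq_nonneg (‖amp ℕ (a : H →L[ℂ] H) ξ'‖ - ‖amp ℕ (a : H →L[ℂ] H) η'‖),
    sq_nonneg (‖amp ℕ (a : H →L[ℂ] H) ξ'‖), sq_nonneg ‖amp ℕ (a : H →L[ℂ] H) η'‖]

/-- A faithful normal positive functional dominates a separating vector functional. -/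
theorem exists_dominated (hf : ∀ a : M, φ (star a * a) = 0 → a = 0) (hn : IsNormal φ) :
    ∃ w : lp (fun _ : ℕ ⊕ ℕ => H) 2,
      (∀ a : M, ‖amp (ℕ ⊕ ℕ) (a : H →L[ℂ] H) w‖ ≤ ‖φ.toPreGNS a‖) ∧
      ∀ a : M, amp (ℕ ⊕ ℕ) (a : H →L[ℂ] H) w = 0 → a = 0 := by
  obtain ⟨x, hx⟩ := exists_dominating φ hn
  let F : M →ₗ[ℂ] lp (fun _ : ℕ ⊕ ℕ => H) 2 :=
    { toFun := fun a => amp (ℕ ⊕ ℕ) (a : H →L[ℂ] H) x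
      map_add' := fun a b => amp_add _ _ _
      map_smul' := fun c a => amp_smul _ _ _ }
  have hF : ∀ a, F a = amp (ℕ ⊕ ℕ) (a : H →L[ℂ] H) x := fun _ => rfl
  have hinj : Function.Injective F := by
    rw [injective_iff_map_eq_zero]
    intro a ha
    have h1 : ‖φ.toPreGNS a‖ = 0 :=
      le_antisymm ((hx a).trans (by rw [← hF, ha, norm_zero])) (norm_nonneg _)
    apply hf
    rw [← gns_norm_sq, h1]; simp
  let e := LinearEquiv.ofInjective F hinj
  let g₀ : LinearMap.range F →ₗ[ℂ] ℂ := φ.toLinearMap ∘ₗ e.symm.toLinearMap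
  have hg₀ : ∀ a, g₀ (e a) = φ a := fun a => by simp [g₀]
  let g : StrongDual ℂ (LinearMap.range F) := g₀.mkContinuous ‖φ.toPreGNS 1‖ (by
    intro y
    obtain ⟨a, rfl⟩ := e.surjective y
    rw [hg₀]
    have h1 := norm_apply_le_gns φ 1 a
    rw [star_one, one_mul] at h1
    exact h1.trans (mul_le_mul_of_nonneg_left (hx a) (norm_nonneg _)))
  obtain ⟨g', hg', -⟩ := exists_extension_norm_eq (LinearMap.range F) g
  obtain ⟨w₀, rfl⟩ := (InnerProductSpace.toDual ℂ _).surjective g'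
  have hw₀ : ∀ a : M, ⟪w₀, F a⟫_ℂ = φ a := by
    intro a
    have := hg' (e a)
    rw [InnerProductSpace.toDual_apply_apply] at this
    exact this.trans (hg₀ a)
  set V := (orbit M.toStarSubalgebra x).topologicalClosure with hV
  have : CompleteSpace V :=
    (orbit M.toStarSubalgebra x).isClosed_topologicalClosure.completeSpace_coe
  have hFV : ∀ a, F a ∈ V := fun a => Submodule.le_topologicalClosure _ ⟨a, a.2, rfl⟩
  set w := V.starProjection w₀ with hwdef
  have hw : ∀ a : M, ⟪w, F a⟫_ℂ = φ a := by
    intro a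
    have := V.starProjection_inner_eq_zero w₀ _ (hFV a)
    rw [inner_sub_left, sub_eq_zero] at this
    rw [← hw₀ a, this]
  have hwV : w ∈ V := Submodule.starProjection_apply_mem _ _
  have hinner : ∀ a b : M, ⟪amp (ℕ ⊕ ℕ) (a : H →L[ℂ] H) w, F b⟫_ℂ = φ (star a * b) := by
    intro a b
    rw [amp_inner, ← hw]; rfl
  refine ⟨w, fun a => ?_, fun a ha => ?_⟩
  · set v := amp (ℕ ⊕ ℕ) (a : H →L[ℂ] H) w with hv
    have hvV : v ∈ V := orbit_closure_invariant M.toStarSubalgebra x a.2 hwV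
    have hb : ∀ y ∈ V, ‖⟪v, y⟫_ℂ‖ ≤ ‖φ.toPreGNS a‖ * ‖y‖ := by
      have hcl : IsClosed {y : lp (fun _ : ℕ ⊕ ℕ => H) 2 |
          ‖⟪v, y⟫_ℂ‖ ≤ ‖φ.toPreGNS a‖ * ‖y‖} :=
        isClosed_le (by fun_prop) (by fun_prop)
      refine fun y hy => closure_minimal ?_ hcl hy
      rintro _ ⟨b, hb, rfl⟩
      have h1 : ⟪v, amp (ℕ ⊕ ℕ) b x⟫_ℂ = φ (star a * (⟨b, hb⟩ : M)) := hinner a ⟨b, hb⟩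
      change ‖⟪v, amp (ℕ ⊕ ℕ) b x⟫_ℂ‖ ≤ _
      rw [h1]
      exact (norm_apply_le_gns φ _ _).trans
        (mul_le_mul_of_nonneg_left (hx ⟨b, hb⟩) (norm_nonneg _))
    have h2 := hb v hvV
    rw [inner_self_eq_norm_sq_to_K, norm_pow, RCLike.norm_ofReal, abs_norm, sq] at h2
    rcases (norm_nonneg v).eq_or_lt with h0 | h0
    · rw [← h0]; exact norm_nonneg _
    · exact le_of_mul_le_mul_right h2 h0
  · apply hf
    rw [← hinner a a, ha, inner_zero_left]

/-- A state-preserving automorphism of `M` that maps a star subalgebra `S` of `M` into itself also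
maps its double commutant into itself. -/
theorem automorphism_mem (hf : ∀ a : M, φ (star a * a) = 0 → a = 0) (hn : IsNormal φ)
    (α : M ≃⋆ₐ[ℂ] M) (hα : ∀ a, φ (α a) = φ a) (S : StarSubalgebra ℂ (H →L[ℂ] H))
    (hSM : ∀ s ∈ S, s ∈ M) (hS : ∀ s : M, (s : H →L[ℂ] H) ∈ S → (α s : H →L[ℂ] H) ∈ S) (a : M)
    (ha : (a : H →L[ℂ] H) ∈ (S : Set (H →L[ℂ] H)).centralizer.centralizer) :
    (α a : H →L[ℂ] H) ∈ (S : Set (H →L[ℂ] H)).centralizer.centralizer := by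
  obtain ⟨x, hx⟩ := exists_dominating φ hn
  obtain ⟨w, hw, hsep⟩ := exists_dominated φ hf hn
  have hαn : ∀ b : M, ‖φ.toPreGNS (α b)‖ = ‖φ.toPreGNS b‖ := by
    intro b
    rw [← sq_eq_sq₀ (norm_nonneg _) (norm_nonneg _), ← Complex.ofReal_inj, gns_norm_sq,
      gns_norm_sq, ← map_star, ← map_mul, hα]
  -- the vectors `d (w i)`, with `d` in the commutant of `M`, span a dense subspace
  set D : Submodule ℂ H := Submodule.span ℂ {v | ∃ d ∈ M.commutant, ∃ i, d (w i) = v} with hD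
  have hdense : D.topologicalClosure = ⊤ := by
    set W := D.topologicalClosure with hW
    have : CompleteSpace W := D.isClosed_topologicalClosure.completeSpace_coe
    have hinv : ∀ d ∈ M.commutant, ∀ y ∈ W, d y ∈ W := by
      intro d hd y hy
      have : Set.MapsTo d D D := by
        intro v hv
        induction hv using Submodule.span_induction with
        | mem v hv =>
          obtain ⟨d', hd', i, rfl⟩ := hv
          exact Submodule.subset_span ⟨d * d', mul_mem hd hd', i, rfl⟩
        | zero => simp
        | add u v _ _ hu hv => rw [map_add]; exact add_mem hu hv
        | smul c v _ hv => rw [map_smul]; exact D.smul_mem c hv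
      exact this.closure d.continuous hy
    have hp : (1 - W.starProjection : H →L[ℂ] H) ∈ M := by
      refine sub_mem (one_mem M) ?_
      rw [← M.commutant_commutant, mem_commutant_iff]
      intro d hd
      ext v
      exact (starProjection_comm W d (star d)
        (fun x y => by
          rw [ContinuousLinearMap.star_eq_adjoint, ContinuousLinearMap.adjoint_inner_right])
        (hinv d hd) (hinv _ (star_mem hd)) v).symm
    have h0 := hsep ⟨_, hp⟩ (by
      ext i
      have hwi : w i ∈ W := Submodule.le_topologicalClosure _
        (Submodule.subset_span ⟨1, one_mem _, i, rfl⟩)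
      have := Submodule.starProjection_eq_self_iff.mpr hwi
      simp [this])
    have h1 : W.starProjection = 1 := by
      have := congrArg Subtype.val h0
      exact (sub_eq_zero.mp this).symm
    rw [eq_top_iff]
    intro v _
    have := Submodule.starProjection_apply_mem W v
    rwa [h1] at this
  -- the case of a self-adjoint element
  have hsa : ∀ b : M, star b = b →
      (b : H →L[ℂ] H) ∈ (S : Set (H →L[ℂ] H)).centralizer.centralizer →
      (α b : H →L[ℂ] H) ∈ (S : Set (H →L[ℂ] H)).centralizer.centralizer := by
    intro b hb hbS c hc
    set β : H →L[ℂ] H := (α b : H →L[ℂ] H) with hβ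
    have hβsa : star β = β := by
      have : star (α b) = α b := by rw [← map_star, hb]
      exact congrArg Subtype.val this
    have happrox : ∀ n : ℕ, ∃ s : M, (s : H →L[ℂ] H) ∈ S ∧ star s = s ∧
        ‖amp (ℕ ⊕ ℕ) ((α s : H →L[ℂ] H) - β) w‖ < 1 / ((n : ℝ) + 1) := by
      intro n
      obtain ⟨s, hs, hs', hlt⟩ := exists_selfAdjoint_approx S hbS
        (congrArg Subtype.val hb) x (Nat.one_div_pos_of_nat (n := n) (α := ℝ))
      refine ⟨⟨s, hSM s hs⟩, hs, Subtype.ext hs', lt_of_le_of_lt ?_ hlt⟩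
      have h1 := hw (α (⟨s, hSM s hs⟩ - b))
      rw [hαn] at h1
      have h2 := h1.trans (hx _)
      simpa [map_sub] using h2
    choose s hsS hs hlim using happrox
    have hconv : ∀ i, Filter.Tendsto (fun n => (α (s n) : H →L[ℂ] H) (w i)) Filter.atTop
        (nhds (β (w i))) := by
      intro i
      rw [tendsto_iff_norm_sub_tendsto_zero]
      refine squeeze_zero (fun _ => norm_nonneg _) (fun n => ?_)
        (tendsto_one_div_add_atTop_nhds_zero_nat (𝕜 := ℝ))
      refine le_trans ?_ (hlim n).le
      exact lp.norm_apply_le_norm (by norm_num) (amp (ℕ ⊕ ℕ) ((α (s n) : H →L[ℂ] H) - β) w) i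
    have hself : ∀ T : H →L[ℂ] H, star T = T → ∀ u v, ⟪u, T v⟫_ℂ = ⟪T u, v⟫_ℂ := by
      intro T hT u v
      conv_lhs => rw [← hT]
      rw [ContinuousLinearMap.star_eq_adjoint, ContinuousLinearMap.adjoint_inner_right]
    have hcomm : ∀ d ∈ M.commutant, ∀ m : M, ∀ v,
        (m : H →L[ℂ] H) (d v) = d ((m : H →L[ℂ] H) v) := fun d hd m v =>
      DFunLike.congr_fun (mem_commutant_iff.mp hd m m.2) v
    have hmain : ∀ d ∈ M.commutant, ∀ e ∈ M.commutant, ∀ i j,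
        ⟪d (w i), (c * β) (e (w j))⟫_ℂ = ⟪d (w i), (β * c) (e (w j))⟫_ℂ := by
      intro d hd e he i j
      have h1 : Filter.Tendsto
          (fun n => ⟪d ((α (s n) : H →L[ℂ] H) (w i)), c (e (w j))⟫_ℂ) Filter.atTop
          (nhds ⟪d (β (w i)), c (e (w j))⟫_ℂ) :=
        ((d.continuous.tendsto _).comp (hconv i)).inner tendsto_const_nhds
      have h2 : Filter.Tendsto
          (fun n => ⟪d (w i), c (e ((α (s n) : H →L[ℂ] H) (w j)))⟫_ℂ) Filter.atTop
          (nhds ⟪d (w i), c (e (β (w j)))⟫_ℂ) :=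
        tendsto_const_nhds.inner
          ((c.continuous.tendsto _).comp ((e.continuous.tendsto _).comp (hconv j)))
      have h3 : ∀ n, ⟪d ((α (s n) : H →L[ℂ] H) (w i)), c (e (w j))⟫_ℂ =
          ⟪d (w i), c (e ((α (s n) : H →L[ℂ] H) (w j)))⟫_ℂ := by
        intro n
        have hst : star (α (s n) : H →L[ℂ] H) = (α (s n) : H →L[ℂ] H) := by
          have : star (α (s n)) = α (s n) := by rw [← map_star, hs]
          exact congrArg Subtype.val this
        rw [← hcomm d hd, ← hself _ hst, ← hcomm e he]
        have := DFunLike.congr_fun (hc _ (hS _ (hsS n))) (e (w j))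
        simp only [mul_apply_eq_comp] at this
        rw [this]
      have h4 := tendsto_nhds_unique (h1.congr h3) h2
      simp only [mul_apply_eq_comp]
      rw [hself β hβsa, hβ, hcomm d hd, hcomm e he, ← hβ, h4]
    have hext : ∀ T : H →L[ℂ] H, (∀ d ∈ M.commutant, ∀ e ∈ M.commutant, ∀ i j,
        ⟪d (w i), T (e (w j))⟫_ℂ = 0) → T = 0 := by
      intro T hT
      have hdD : Dense (D : Set H) := by
        rw [Submodule.dense_iff_topologicalClosure_eq_top]; exact hdense
      have hTD : ∀ v ∈ D, T v = 0 := by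
        intro v hv
        induction hv using Submodule.span_induction with
        | mem v hv =>
          obtain ⟨e, he, j, rfl⟩ := hv
          refine hdD.eq_zero_of_inner_right ℂ ?_
          intro u hu
          induction hu using Submodule.span_induction with
          | mem u hu =>
            obtain ⟨d, hd, i, rfl⟩ := hu
            exact hT d hd e he i j
          | zero => simp
          | add u v _ _ hu hv => simp only [inner_add_left, hu, hv, add_zero]
          | smul c v _ hv => simp only [inner_smul_left, hv, mul_zero]
        | zero => simp
        | add u v _ _ hu hv => rw [map_add, hu, hv, add_zero]
        | smul c v _ hv => rw [map_smul, hv, smul_zero]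
      ext v
      exact congrFun (Continuous.ext_on hdD T.continuous continuous_zero hTD) v
    have h5 := hext (c * β - β * c) (fun d hd e he i j => by
      rw [sub_apply, inner_sub_right, hmain d hd e he, sub_self])
    exact sub_eq_zero.mp h5
  -- the general case
  have hN : ∀ b : M, (b : H →L[ℂ] H) ∈ (S : Set (H →L[ℂ] H)).centralizer.centralizer ↔
      (b : H →L[ℂ] H) ∈ generatedBy (S : Set (H →L[ℂ] H)) := by
    intro b
    rw [← SetLike.mem_coe, coe_generatedBy, StarMemClass.star_coe_eq, Set.union_self]
  rw [hN] at ha ⊢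
  have h1 := hsa (a + star a) (by rw [star_add, star_star, add_comm])
    ((hN _).mpr (add_mem ha (star_mem ha)))
  have h2 := hsa (Complex.I • (a - star a)) (by
      rw [star_smul, star_sub, star_star]
      simp only [RCLike.star_def, Complex.conj_I]
      module)
    ((hN _).mpr (SMulMemClass.smul_mem _ (sub_mem ha (star_mem ha))))
  rw [hN] at h1 h2
  have h3 : α a = (1 / 2 : ℂ) • α (a + star a) +
      (-(Complex.I / 2)) • α (Complex.I • (a - star a)) := by
    rw [← map_smul, ← map_smul, ← map_add, smul_smul]
    congr 1
    have : -(Complex.I / 2) * Complex.I = 1 / 2 := by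
      linear_combination (-1 / 2 : ℂ) * Complex.I_mul_I
    rw [this, ← smul_add, add_add_sub_cancel, ← two_smul ℂ a, smul_smul]
    norm_num
  rw [h3]
  exact add_mem (SMulMemClass.smul_mem _ h1) (SMulMemClass.smul_mem _ h2)

end state

end VonNeumannAlgebra

namespace WStarSystem

variable {G : Type*} [Group G] {H : Type*} [NormedAddCommGroup H] [InnerProductSpace ℂ H]
  [CompleteSpace H] (A : WStarSystem G H)

/-- The action maps `A^K` into itself. -/
theorem action_mem_compactAlgebra (g : G) (a : A.algebra)
    (ha : (a : H →L[ℂ] H) ∈ A.compactAlgebra) :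
    (A.action g a : H →L[ℂ] H) ∈ A.compactAlgebra := by
  set E : Set (H →L[ℂ] H) :=
    {a | ∃ u : A.algebra, A.IsEigenoperator u ∧ (u : H →L[ℂ] H) = a} with hE
  have hEA : E ⊆ A.algebra.toStarSubalgebra := by rintro _ ⟨u, -, rfl⟩; exact u.2
  set S : StarSubalgebra ℂ (H →L[ℂ] H) := StarAlgebra.adjoin ℂ E with hS
  have hSA : S ≤ A.algebra.toStarSubalgebra := StarAlgebra.adjoin_le hEA
  have hcl : (S : Set (H →L[ℂ] H)).centralizer.centralizer =
      (A.compactAlgebra : Set (H →L[ℂ] H)) := by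
    apply Set.Subset.antisymm
    · rw [← A.compactAlgebra.centralizer_centralizer]
      refine Set.centralizer_subset (Set.centralizer_subset ?_)
      exact StarAlgebra.adjoin_le (S := A.compactAlgebra.toStarSubalgebra)
        (VonNeumannAlgebra.subset_generatedBy E)
    · change (VonNeumannAlgebra.generatedBy E : Set (H →L[ℂ] H)) ⊆ _
      rw [VonNeumannAlgebra.coe_generatedBy]
      refine Set.centralizer_subset (Set.centralizer_subset ?_)
      exact Set.union_subset (StarAlgebra.subset_adjoin ℂ E)
        (StarAlgebra.star_subset_adjoin ℂ E)
  have hinv : ∀ s ∈ S, ∃ h : s ∈ A.algebra, (A.action g ⟨s, h⟩ : H →L[ℂ] H) ∈ S := by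
    intro s hs
    induction hs using StarAlgebra.adjoin_induction with
    | mem s hs =>
      have hs' := hs
      obtain ⟨u, ⟨-, χ, hχ⟩, rfl⟩ := hs
      refine ⟨u.2, ?_⟩
      rw [Subtype.coe_eta, hχ g]
      exact SMulMemClass.smul_mem (χ g) (StarAlgebra.subset_adjoin ℂ E hs')
    | algebraMap r =>
      refine ⟨A.algebra.toStarSubalgebra.algebraMap_mem r, ?_⟩
      have : (⟨algebraMap ℂ (H →L[ℂ] H) r, A.algebra.toStarSubalgebra.algebraMap_mem r⟩ :
          A.algebra) = r • 1 := Subtype.ext (Algebra.algebraMap_eq_smul_one r)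
      rw [this, map_smul, map_one]
      exact SMulMemClass.smul_mem r (one_mem S)
    | add x y _ _ hx hy =>
      obtain ⟨hx, hx'⟩ := hx
      obtain ⟨hy, hy'⟩ := hy
      refine ⟨add_mem hx hy, ?_⟩
      have : (⟨x + y, add_mem hx hy⟩ : A.algebra) = ⟨x, hx⟩ + ⟨y, hy⟩ := rfl
      rw [this, map_add]
      exact add_mem hx' hy'
    | mul x y _ _ hx hy =>
      obtain ⟨hx, hx'⟩ := hx
      obtain ⟨hy, hy'⟩ := hy
      refine ⟨mul_mem hx hy, ?_⟩
      have : (⟨x * y, mul_mem hx hy⟩ : A.algebra) = ⟨x, hx⟩ * ⟨y, hy⟩ := rfl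
      rw [this, map_mul]
      exact mul_mem hx' hy'
    | star x _ hx =>
      obtain ⟨hx, hx'⟩ := hx
      refine ⟨star_mem hx, ?_⟩
      have : (⟨star x, star_mem hx⟩ : A.algebra) = star ⟨x, hx⟩ := rfl
      rw [this, map_star]
      exact star_mem hx'
  have := VonNeumannAlgebra.automorphism_mem A.state A.faithful A.normal (A.action g)
    (A.state_action g) S hSA (fun s hs => (hinv s hs).2) a
    (by rw [hcl]; exact ha)
  rwa [hcl] at this

/-- The inclusion of `A^K` into the algebra of the system. -/
def compactIncl (a : A.compactAlgebra) : A.algebra := ⟨a, A.compactAlgebra_le a.2⟩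

/-- The restriction of `α_g` to `A^K`. -/
noncomputable def compactAction (g : G) : A.compactAlgebra ≃⋆ₐ[ℂ] A.compactAlgebra where
  toFun a := ⟨A.action g (A.compactIncl a), A.action_mem_compactAlgebra g _ a.2⟩
  invFun a := ⟨A.action g⁻¹ (A.compactIncl a), A.action_mem_compactAlgebra g⁻¹ _ a.2⟩
  left_inv a := by
    apply Subtype.ext
    change ((A.action g⁻¹ (A.action g (A.compactIncl a)) : A.algebra) : H →L[ℂ] H) = a
    rw [← StarAlgEquiv.mul_apply, ← map_mul, inv_mul_cancel, map_one]
    rfl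
  right_inv a := by
    apply Subtype.ext
    change ((A.action g (A.action g⁻¹ (A.compactIncl a)) : A.algebra) : H →L[ℂ] H) = a
    rw [← StarAlgEquiv.mul_apply, ← map_mul, mul_inv_cancel, map_one]
    rfl
  map_mul' a b := by
    have h := congrArg Subtype.val (map_mul (A.action g) (A.compactIncl a) (A.compactIncl b))
    exact Subtype.ext h
  map_add' a b := by
    have h := congrArg Subtype.val (map_add (A.action g) (A.compactIncl a) (A.compactIncl b))
    exact Subtype.ext h
  map_star' a := by
    have h := congrArg Subtype.val (map_star (A.action g) (A.compactIncl a))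
    exact Subtype.ext h
  map_smul' c a := by
    have h := congrArg Subtype.val (map_smul (A.action g) c (A.compactIncl a))
    exact Subtype.ext h

/-- The compact subsystem `(A^K, μ^K, α^K)`: the state and the action of the system, restricted to
the von Neumann algebra generated by the eigenoperators. -/
noncomputable def compactSubsystem : WStarSystem G H where
  algebra := A.compactAlgebra
  state :=
    { toFun := fun a => A.state (A.compactIncl a)
      map_add' := fun a b => map_add A.state (A.compactIncl a) (A.compactIncl b)
      map_smul' := fun c a => map_smul A.state c (A.compactIncl a)
      monotone' := fun a b h =>
        A.state.monotone' (show A.compactIncl a ≤ A.compactIncl b from h) }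
  state_one := A.state_one
  faithful a ha := by
    have h := congrArg Subtype.val (A.faithful (A.compactIncl a) ha)
    exact Subtype.ext h
  normal := by
    obtain ⟨ξ, η, hξ, hη, h⟩ := A.normal
    exact ⟨ξ, η, hξ, hη, fun a => h (A.compactIncl a)⟩
  action :=
    { toFun := A.compactAction
      map_one' := by
        ext a : 2
        change ((A.action 1 (A.compactIncl a) : A.algebra) : H →L[ℂ] H) = a
        rw [map_one]; rfl
      map_mul' := fun g h => by
        ext a : 2
        change ((A.action (g * h) (A.compactIncl a) : A.algebra) : H →L[ℂ] H) =
          A.action g (A.action h (A.compactIncl a))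
        rw [map_mul]; rfl }
  state_action g a := A.state_action g (A.compactIncl a)

end WStarSystem

/-!
An eigenoperator `u` yields the eigenvector `γ_μ(u)` of `U`, which is nonzero because the state is
faithful. So if `H₀` is one-dimensional, it is spanned by `γ_μ(1)`, every eigenoperator is scalar
(`γ_μ` is injective), and the von Neumann algebra generated by scalars is `ℂ 1`.

The converse has to produce eigenoperators from eigenvectors, which need not lie in `γ_μ(A)`. The
tool is `VonNeumannAlgebra.isClosed_image_ball`: the image in the GNS space of a norm ball of the
algebra is closed, because on norm-bounded sequences of operators GNS convergence amounts to
strong convergence. Given an eigenvector `x` with character `χ` and `a` in the algebra, consider the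
vectors `γ_μ(b)` with `‖b‖ ≤ ‖a‖` and `⟪x, γ_μ(b)⟫ = ⟪x, γ_μ(a)⟫`. They form a nonempty closed convex
set, invariant under the unitaries `χ(g)⁻¹ U_g`, so its unique point of least norm is fixed by them:
it is `γ_μ(b)` with `α_g(b) = χ(g) b` (`WStarSystem.exists_eigenoperator`). If all eigenoperators
are scalar, then for `x` orthogonal to `γ_μ(1)` this gives
`⟪x, γ_μ(a)⟫ = ⟪x, γ_μ(b)⟫ = 0` for all `a`, and `x = 0` by density. Hence the eigenvectors are the
nonzero multiples of `γ_μ(1)`, as the component of an eigenvector orthogonal to `γ_μ(1)` is again an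
eigenvector or zero.
-/

namespace VonNeumannAlgebra

variable {H : Type*} [NormedAddCommGroup H] [InnerProductSpace ℂ H] [CompleteSpace H]

/-! ### Strong convergence of bounded sequences of operators -/

/-- A uniformly bounded sequence of operators that is pointwise Cauchy on a set with dense span
converges strongly, and the limit obeys the same bound. -/
theorem exists_strong_limit {a : ℕ → H →L[ℂ] H} {r : ℝ} (hr : ∀ n, ‖a n‖ ≤ r) {s : Set H}
    (hs : (Submodule.span ℂ s).topologicalClosure = ⊤)
    (hc : ∀ v ∈ s, CauchySeq fun n => a n v) :
    ∃ T : H →L[ℂ] H, ‖T‖ ≤ r ∧ ∀ v, Filter.Tendsto (fun n => a n v) Filter.atTop (nhds (T v)) := by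
  have hr0 : 0 ≤ r := (norm_nonneg _).trans (hr 0)
  have hspan : ∀ v ∈ Submodule.span ℂ s, CauchySeq fun n => a n v := by
    intro v hv
    induction hv using Submodule.span_induction with
    | mem v hv => exact hc v hv
    | zero => simpa using cauchySeq_const (0 : H)
    | add u v _ _ hu hv => simpa [Pi.add_def] using hu.add hv
    | smul c v _ hv =>
      simpa [Function.comp_def] using (uniformContinuous_const_smul c).comp_cauchySeq hv
  have hall : ∀ v, CauchySeq fun n => a n v := by
    intro v
    rw [Metric.cauchySeq_iff']
    intro ε hε
    have hv : v ∈ closure (Submodule.span ℂ s : Set H) := by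
      change v ∈ (Submodule.span ℂ s).topologicalClosure
      rw [hs]; trivial
    obtain ⟨u, hu, hvu⟩ := Metric.mem_closure_iff.mp hv (ε / (4 * (r + 1))) (by positivity)
    obtain ⟨N, hN⟩ := Metric.cauchySeq_iff'.mp (hspan u hu) (ε / 2) (by positivity)
    refine ⟨N, fun n hn => ?_⟩
    have hb : ∀ k, dist (a k v) (a k u) ≤ ε / 4 := by
      intro k
      rw [dist_eq_norm, ← map_sub]
      calc ‖a k (v - u)‖ ≤ (r + 1) * ‖v - u‖ :=
            (a k).le_of_opNorm_le ((hr k).trans (by linarith)) _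
        _ ≤ (r + 1) * (ε / (4 * (r + 1))) := by
            rw [← dist_eq_norm]; gcongr
        _ = ε / 4 := by field_simp
    have h1 := hb n
    have h2 := hb N
    have h3 := hN n hn
    rw [dist_comm] at h2
    have h4 := dist_triangle4 (a n v) (a n u) (a N u) (a N v)
    linarith
  choose f hf using fun v => cauchySeq_tendsto_of_complete (hall v)
  refine ⟨continuousLinearMapOfTendsto a (tendsto_pi_nhds.mpr hf), ?_, hf⟩
  refine ContinuousLinearMap.opNorm_le_bound _ hr0 fun v => ?_
  exact le_of_tendsto (hf v).norm (Filter.Eventually.of_forall fun n =>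
    (a n).le_of_opNorm_le (hr n) v)

/-- A von Neumann algebra is sequentially closed in the strong operator topology. -/
theorem mem_of_tendsto (M : VonNeumannAlgebra H) {a : ℕ → H →L[ℂ] H} (ha : ∀ n, a n ∈ M)
    {T : H →L[ℂ] H} (hT : ∀ v, Filter.Tendsto (fun n => a n v) Filter.atTop (nhds (T v))) :
    T ∈ M := by
  rw [← M.commutant_commutant, mem_commutant_iff]
  intro d hd
  ext v
  refine tendsto_nhds_unique ((d.continuous.tendsto _).comp (hT v)) ((hT (d v)).congr fun n => ?_)
  exact DFunLike.congr_fun (mem_commutant_iff.mp hd (a n) (ha n)) v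

/-- On bounded sequences, strong convergence to `0` passes to amplifications. -/
theorem tendsto_amp_zero {ι : Type*} {b : ℕ → H →L[ℂ] H} {r : ℝ} (hr : ∀ n, ‖b n‖ ≤ r)
    (hb : ∀ v, Filter.Tendsto (fun n => b n v) Filter.atTop (nhds 0))
    (x : lp (fun _ : ι => H) 2) :
    Filter.Tendsto (fun n => ‖amp ι (b n) x‖) Filter.atTop (nhds 0) := by
  have hr0 : 0 ≤ r := (norm_nonneg _).trans (hr 0)
  have hsq : ∀ y : lp (fun _ : ι => H) 2, HasSum (fun i => ‖y i‖ ^ 2) (‖y‖ ^ 2) := by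
    intro y
    simpa using lp.hasSum_norm (p := 2) (by norm_num) y
  have h1 : Filter.Tendsto (fun n => ∑' i, ‖b n (x i)‖ ^ 2) Filter.atTop
      (nhds (∑' _ : ι, (0 : ℝ))) := by
    refine tendsto_tsum_of_dominated_convergence (bound := fun i => r ^ 2 * ‖x i‖ ^ 2)
      ((hsq x).summable.mul_left _) (fun i => by simpa using (hb (x i)).norm.pow 2) ?_
    refine Filter.Eventually.of_forall fun n i => ?_
    rw [norm_pow, norm_norm, ← mul_pow]
    exact pow_le_pow_left₀ (norm_nonneg _) ((b n).le_of_opNorm_le (hr n) _) 2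
  have h2 : ∀ n, ∑' i, ‖b n (x i)‖ ^ 2 = ‖amp ι (b n) x‖ ^ 2 := fun n =>
    (hsq (amp ι (b n) x)).tsum_eq
  simp only [h2, tsum_zero] at h1
  simpa [Real.sqrt_sq (norm_nonneg _)] using h1.sqrt

/-- If the family `w` separates `M`, then the vectors `d (w i)`, with `d` in the commutant of `M`,
span a dense subspace. -/
theorem span_commutant_eq_top {M : VonNeumannAlgebra H} {ι : Type*} {w : lp (fun _ : ι => H) 2}
    (hsep : ∀ a : M, amp ι (a : H →L[ℂ] H) w = 0 → a = 0) :
    (Submodule.span ℂ {v | ∃ d ∈ M.commutant, ∃ i, d (w i) = v}).topologicalClosure = ⊤ := by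
  set D : Submodule ℂ H := Submodule.span ℂ {v | ∃ d ∈ M.commutant, ∃ i, d (w i) = v} with hD
  set W := D.topologicalClosure with hW
  have : CompleteSpace W := D.isClosed_topologicalClosure.completeSpace_coe
  have hinv : ∀ d ∈ M.commutant, ∀ y ∈ W, d y ∈ W := by
    intro d hd y hy
    have : Set.MapsTo d D D := by
      intro v hv
      induction hv using Submodule.span_induction with
      | mem v hv =>
        obtain ⟨d', hd', i, rfl⟩ := hv
        exact Submodule.subset_span ⟨d * d', mul_mem hd hd', i, rfl⟩
      | zero => simp
      | add u v _ _ hu hv => rw [map_add]; exact add_mem hu hv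
      | smul c v _ hv => rw [map_smul]; exact D.smul_mem c hv
    exact this.closure d.continuous hy
  -- the projection onto `Wᗮ` lies in `M` and annihilates the separating family
  have hp : (1 - W.starProjection : H →L[ℂ] H) ∈ M := by
    refine sub_mem (one_mem M) ?_
    rw [← M.commutant_commutant, mem_commutant_iff]
    intro d hd
    ext v
    exact (starProjection_comm W d (star d)
      (fun x y => by
        rw [ContinuousLinearMap.star_eq_adjoint, ContinuousLinearMap.adjoint_inner_right])
      (hinv d hd) (hinv _ (star_mem hd)) v).symm
  have h0 := hsep ⟨_, hp⟩ (by
    ext i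
    have hwi : w i ∈ W := Submodule.le_topologicalClosure _
      (Submodule.subset_span ⟨1, one_mem _, i, rfl⟩)
    have := Submodule.starProjection_eq_self_iff.mpr hwi
    simp [this])
  have h1 : W.starProjection = 1 := by
    have := congrArg Subtype.val h0
    exact (sub_eq_zero.mp this).symm
  rw [eq_top_iff]
  intro v _
  have := Submodule.starProjection_apply_mem W v
  rwa [h1] at this

/-! ### Norm balls of the algebra in the GNS space -/

/-- A norm-bounded sequence in the algebra that is Cauchy for the GNS norm of a faithful normal
positive functional converges, in that norm, to an element of the algebra. On bounded sequences,
convergence in the GNS norm forces strong convergence, as the functional dominates a separating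
vector functional of an amplification; conversely the functional is dominated by a vector
functional, so that the strong limit is also the GNS limit. -/
theorem exists_gns_limit {M : VonNeumannAlgebra H} (φ : M →ₚ[ℂ] ℂ)
    (hf : ∀ a : M, φ (star a * a) = 0 → a = 0) (hn : IsNormal φ) {a : ℕ → M} {r : ℝ}
    (har : ∀ n, ‖a n‖ ≤ r) (ha : CauchySeq fun n => φ.toPreGNS (a n)) :
    ∃ b : M, ‖b‖ ≤ r ∧
      Filter.Tendsto (fun n => φ.toPreGNS (a n)) Filter.atTop (nhds (φ.toPreGNS b)) := by
  obtain ⟨x, hx⟩ := exists_dominating φ hn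
  obtain ⟨w, hw, hsep⟩ := exists_dominated φ hf hn
  have hcauchy : ∀ v ∈ {v | ∃ d ∈ M.commutant, ∃ i, d (w i) = v},
      CauchySeq fun n => (a n : H →L[ℂ] H) v := by
    rintro _ ⟨d, hd, i, rfl⟩
    have h1 : CauchySeq fun n => (a n : H →L[ℂ] H) (w i) := by
      rw [Metric.cauchySeq_iff] at ha ⊢
      intro ε hε
      obtain ⟨N, hN⟩ := ha ε hε
      refine ⟨N, fun m hm n hn => lt_of_le_of_lt ?_ (hN m hm n hn)⟩
      rw [dist_eq_norm, dist_eq_norm, ← map_sub φ.toPreGNS]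
      exact (lp.norm_apply_le_norm (by norm_num)
        (amp (ℕ ⊕ ℕ) ((a m - a n : M) : H →L[ℂ] H) w) i).trans (hw (a m - a n))
    have h2 : ∀ n, (a n : H →L[ℂ] H) (d (w i)) = d ((a n : H →L[ℂ] H) (w i)) := fun n =>
      DFunLike.congr_fun (mem_commutant_iff.mp hd (a n) (a n).2) (w i)
    simp only [h2]
    exact d.uniformContinuous.comp_cauchySeq h1
  obtain ⟨T, hTr, hT⟩ := exists_strong_limit (a := fun n => (a n : H →L[ℂ] H)) har
    (span_commutant_eq_top hsep) hcauchy
  have hTM : T ∈ M := M.mem_of_tendsto (fun n => (a n).2) hT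
  obtain ⟨b, rfl⟩ : ∃ b : M, (b : H →L[ℂ] H) = T := ⟨⟨T, hTM⟩, rfl⟩
  refine ⟨b, hTr, ?_⟩
  rw [tendsto_iff_dist_tendsto_zero]
  have h3 := tendsto_amp_zero (b := fun n => ((a n - b : M) : H →L[ℂ] H)) (r := r + r)
    (fun n => (norm_sub_le (a n) b).trans (add_le_add (har n) hTr))
    (fun v => by simpa using (hT v).sub_const ((b : H →L[ℂ] H) v)) x
  refine squeeze_zero (fun _ => dist_nonneg) (fun n => ?_) h3
  rw [dist_eq_norm, ← map_sub φ.toPreGNS]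
  exact hx (a n - b)

/-- The image of a norm ball of the algebra in the GNS space of a faithful normal positive
functional is closed. -/
theorem isClosed_image_ball {M : VonNeumannAlgebra H} (φ : M →ₚ[ℂ] ℂ)
    (hf : ∀ a : M, φ (star a * a) = 0 → a = 0) (hn : IsNormal φ) (r : ℝ) :
    IsClosed ((fun a : M => ((φ.toPreGNS a : φ.PreGNS) : φ.GNS)) '' {a | ‖a‖ ≤ r}) := by
  refine isClosed_of_closure_subset fun y hy => ?_
  obtain ⟨z, hz, hzy⟩ := mem_closure_iff_seq_limit.mp hy
  choose a har haz using hz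
  obtain rfl : (fun n => ((φ.toPreGNS (a n) : φ.PreGNS) : φ.GNS)) = z := funext haz
  have hc : CauchySeq fun n => φ.toPreGNS (a n) := by
    rw [CauchySeq, ← (UniformSpace.Completion.isUniformInducing_coe φ.PreGNS).cauchy_map_iff,
      Filter.map_map]
    exact hzy.cauchySeq
  obtain ⟨b, hb, hab⟩ := exists_gns_limit φ hf hn har hc
  exact ⟨b, hb, tendsto_nhds_unique
    (((UniformSpace.Completion.continuous_coe φ.PreGNS).tendsto _).comp hab) hzy⟩

end VonNeumannAlgebra

/-! ### The point of least norm of a convex set -/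

/-- In a complex Hilbert space, a nonempty closed convex set has exactly one point of least norm. -/
theorem exists_unique_least_norm {E : Type*} [NormedAddCommGroup E] [InnerProductSpace ℂ E]
    [CompleteSpace E] {K : Set E} (hne : K.Nonempty) (hcl : IsClosed K) (hconv : Convex ℝ K) :
    ∃ v ∈ K, ∀ w ∈ K, ‖w‖ ≤ ‖v‖ → w = v := by
  let : InnerProductSpace ℝ E := InnerProductSpace.complexToReal
  obtain ⟨v, hv, hmin⟩ := exists_norm_eq_iInf_of_complete_convex hne hcl.isComplete hconv 0
  have hle : ∀ w ∈ K, ‖v‖ ≤ ‖w‖ := by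
    intro w hw
    have := ciInf_le (f := fun w : K => ‖(0 : E) - w‖)
      ⟨0, Set.forall_mem_range.2 fun _ => norm_nonneg _⟩ ⟨w, hw⟩
    rw [← hmin] at this
    simpa using this
  refine ⟨v, hv, fun w hw hwv => ?_⟩
  have heq : ‖w‖ = ‖v‖ := le_antisymm hwv (hle w hw)
  by_contra hne
  have h1 := (norm_midpoint_lt_iff heq).mpr hne
  refine absurd (hle _ ?_) (not_le.mpr (heq ▸ h1))
  rw [smul_add]
  exact hconv hw hv (by norm_num) (by norm_num) (by norm_num)

namespace WStarSystem

variable {G : Type*} [Group G] {H : Type*} [NormedAddCommGroup H] [InnerProductSpace ℂ H]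
  [CompleteSpace H] (A : WStarSystem G H)

/-! ### The GNS map and the unitary representation -/

theorem inner_gamma (a b : A.algebra) : ⟪A.gamma a, A.gamma b⟫_ℂ = A.state (star a * b) :=
  UniformSpace.Completion.inner_coe _ _

theorem gamma_add (a b : A.algebra) : A.gamma (a + b) = A.gamma a + A.gamma b := by
  simp [gamma, UniformSpace.Completion.coe_add]

theorem gamma_smul (c : ℂ) (a : A.algebra) : A.gamma (c • a) = c • A.gamma a := by
  simp [gamma]

theorem gamma_eq_zero {a : A.algebra} (h : A.gamma a = 0) : a = 0 := by
  apply A.faithful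
  rw [← inner_gamma, h, inner_zero_left]

theorem gamma_injective : Function.Injective A.gamma := by
  intro a b h
  rw [← sub_eq_zero]
  apply A.gamma_eq_zero
  rw [sub_eq_add_neg, ← neg_one_smul ℂ b, gamma_add, gamma_smul, h]
  simp

theorem denseRange_gamma : DenseRange A.gamma :=
  UniformSpace.Completion.denseRange_coe (α := A.state.PreGNS)

theorem gamma_one_ne_zero : A.gamma 1 ≠ 0 := by
  intro h
  have := A.inner_gamma 1 1
  rw [h, inner_zero_left, star_one, one_mul, A.state_one] at this
  exact zero_ne_one this

theorem isClosed_gamma_ball (r : ℝ) : IsClosed (A.gamma '' {a | ‖a‖ ≤ r}) :=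
  VonNeumannAlgebra.isClosed_image_ball A.state A.faithful A.normal r

theorem norm_action (g : G) (a : A.algebra) : ‖A.action g a‖ = ‖a‖ :=
  NonUnitalStarAlgHom.norm_map (A.action g) (A.action g).injective a

theorem inner_U (g : G) (x y : A.gnsSpace) : ⟪A.U g x, A.U g y⟫_ℂ = ⟪x, y⟫_ℂ := by
  refine A.denseRange_gamma.induction_on₂ (p := fun x y => ⟪A.U g x, A.U g y⟫_ℂ = ⟪x, y⟫_ℂ)
    (isClosed_eq (by fun_prop) (by fun_prop)) (fun a b => ?_) x y
  rw [U_gamma, U_gamma, inner_gamma, inner_gamma, ← map_star, ← map_mul, A.state_action]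

theorem norm_U (g : G) (x : A.gnsSpace) : ‖A.U g x‖ = ‖x‖ := by
  rw [@norm_eq_sqrt_re_inner ℂ, @norm_eq_sqrt_re_inner ℂ _ _ _ _ x, inner_U]

theorem norm_eigenvalue {x : A.gnsSpace} (hx : x ≠ 0) {g : G} {c : ℂ} (h : A.U g x = c • x) :
    ‖c‖ = 1 := by
  have h1 := A.norm_U g x
  rw [h, norm_smul] at h1
  exact (mul_eq_right₀ (norm_ne_zero_iff.mpr hx)).mp h1

/-! ### Eigenvectors from eigenoperators -/

theorem IsEigenoperator.isEigenvector {u : A.algebra} (hu : A.IsEigenoperator u) :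
    A.IsEigenvector (A.gamma u) := by
  obtain ⟨h0, χ, hχ⟩ := hu
  exact ⟨fun h => h0 (A.gamma_eq_zero h), χ, fun g => by rw [U_gamma, hχ, gamma_smul]⟩

theorem isEigenoperator_one : A.IsEigenoperator 1 :=
  ⟨fun h => A.gamma_one_ne_zero (by rw [h, ← zero_smul ℂ (1 : A.algebra), gamma_smul, zero_smul]),
    fun _ => 1, fun g => by rw [map_one, one_smul]⟩

theorem gamma_mem_H₀ {u : A.algebra} (hu : A.IsEigenoperator u) : A.gamma u ∈ A.H₀ :=
  Submodule.le_topologicalClosure _ (Submodule.subset_span hu.isEigenvector)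

/-- If `x` is an eigenvector of `U` with character `χ`, then for every `a` in the algebra there is
`b` with `α_g(b) = χ(g) b` whose image under `γ_μ` has the same inner product with `x` as that of
`a`. The vector `γ_μ(b)` is the point of least norm of a convex set that is closed by
`isClosed_gamma_ball` and invariant under the unitaries `χ(g)⁻¹ U_g`. -/
theorem exists_eigenoperator {x : A.gnsSpace} (hx : x ≠ 0) {χ : G → ℂ}
    (hχ : ∀ g, A.U g x = χ g • x) (a : A.algebra) :
    ∃ b : A.algebra, (∀ g, A.action g b = χ g • b) ∧ ⟪x, A.gamma b⟫_ℂ = ⟪x, A.gamma a⟫_ℂ := by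
  have hχ1 : ∀ g, ‖χ g‖ = 1 := fun g => A.norm_eigenvalue hx (hχ g)
  have hχ0 : ∀ g, χ g ≠ 0 := fun g h => by simpa [h] using hχ1 g
  set K : Set A.gnsSpace :=
    A.gamma '' {b | ‖b‖ ≤ ‖a‖} ∩ {y | ⟪x, y⟫_ℂ = ⟪x, A.gamma a⟫_ℂ} with hK
  have hcl : IsClosed K :=
    (A.isClosed_gamma_ball ‖a‖).inter (isClosed_eq (by fun_prop) continuous_const)
  have hconv : Convex ℝ K := by
    rintro _ ⟨⟨b, hb, rfl⟩, hbx⟩ _ ⟨⟨c, hc, rfl⟩, hcx⟩ p q hp hq hpq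
    have hpq' : (p : ℂ) + q = 1 := by exact_mod_cast hpq
    have h : p • A.gamma b + q • A.gamma c = A.gamma ((p : ℂ) • b + (q : ℂ) • c) := by
      rw [gamma_add, gamma_smul, gamma_smul]; rfl
    rw [h]
    refine ⟨⟨_, ?_, rfl⟩, ?_⟩
    · calc ‖(p : ℂ) • b + (q : ℂ) • c‖ ≤ p * ‖b‖ + q * ‖c‖ := by
            refine (norm_add_le _ _).trans_eq ?_
            rw [norm_smul, norm_smul, Complex.norm_of_nonneg hp, Complex.norm_of_nonneg hq]
        _ ≤ p * ‖a‖ + q * ‖a‖ := by gcongr <;> assumption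
        _ = ‖a‖ := by rw [← add_mul, hpq, one_mul]
    · rw [Set.mem_ofPred_eq] at hbx hcx ⊢
      rw [gamma_add, gamma_smul, gamma_smul, inner_add_right, inner_smul_right, inner_smul_right,
        hbx, hcx, ← add_mul, hpq', one_mul]
  obtain ⟨_, ⟨⟨b, hb, rfl⟩, hbx⟩, huniq⟩ :=
    exists_unique_least_norm (K := K) ⟨A.gamma a, ⟨a, le_refl ‖a‖, rfl⟩, rfl⟩ hcl hconv
  refine ⟨b, fun g => ?_, hbx⟩
  have hV : A.gamma ((χ g)⁻¹ • A.action g b) = (χ g)⁻¹ • A.U g (A.gamma b) := by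
    rw [gamma_smul, U_gamma]
  have hfix : A.gamma ((χ g)⁻¹ • A.action g b) = A.gamma b := by
    refine huniq _ ⟨⟨_, ?_, rfl⟩, ?_⟩ ?_
    · rw [Set.mem_ofPred_eq, norm_smul, norm_inv, hχ1, inv_one, one_mul, norm_action]
      exact hb
    · -- `x` is fixed by the unitary `χ(g)⁻¹ U_g`
      have hx' : x = (χ g)⁻¹ • A.U g x := by rw [hχ, smul_smul, inv_mul_cancel₀ (hχ0 g), one_smul]
      have hcc : (starRingEnd ℂ) (χ g)⁻¹ * (χ g)⁻¹ = 1 := by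
        rw [Complex.conj_mul', norm_inv, hχ1]; simp
      rw [Set.mem_ofPred_eq, hV]
      conv_lhs => rw [hx']
      rw [inner_smul_left, inner_smul_right, ← mul_assoc, hcc, one_mul, inner_U]
      exact hbx
    · rw [hV, norm_smul, norm_inv, hχ1, inv_one, one_mul, norm_U]
  rw [← A.gamma_injective hfix, smul_smul, mul_inv_cancel₀ (hχ0 g), one_smul]
  exact congrArg (A.action g) (A.gamma_injective hfix)

/-! ### Trivial compact subsystem and scalar eigenoperators -/

/-- If all eigenoperators are scalar, every eigenvector of `U` is a multiple of `γ_μ(1)`. -/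
theorem IsEigenvector.mem_span_gamma_one
    (hA : ∀ u : A.algebra, A.IsEigenoperator u → ∃ c : ℂ, u = c • 1) {x : A.gnsSpace}
    (hx : A.IsEigenvector x) : x ∈ ℂ ∙ A.gamma 1 := by
  obtain ⟨-, χ, hχ⟩ := hx
  have hone : ∀ g, A.U g (A.gamma 1) = A.gamma 1 := fun g => by rw [U_gamma, map_one]
  obtain ⟨k, hk⟩ := Submodule.mem_span_singleton.mp
    (Submodule.starProjection_apply_mem (ℂ ∙ A.gamma 1) x)
  set y := x - k • A.gamma 1 with hy
  have hy1 : ⟪y, A.gamma 1⟫_ℂ = 0 := by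
    rw [hy, hk]
    exact Submodule.starProjection_inner_eq_zero x _ (Submodule.mem_span_singleton_self _)
  -- eigenvectors with different characters are orthogonal, so that subtracting from `x` its
  -- projection onto the fixed vector `γ_μ(1)` leaves an eigenvector with the same character
  have hyχ : ∀ g, A.U g y = χ g • y := by
    intro g
    have h1 : A.U g y = χ g • y + ((χ g - 1) * k) • A.gamma 1 := by
      rw [hy, map_sub, map_smul, hχ, hone]
      module
    have h2 : ⟪A.U g y, A.gamma 1⟫_ℂ = 0 := by
      conv_lhs => rw [← hone g]
      rw [inner_U, hy1]
    rw [h1, inner_add_left, inner_smul_left, hy1, mul_zero, zero_add, inner_smul_left,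
      mul_eq_zero, map_eq_zero, inner_self_eq_zero] at h2
    rw [h1, h2.resolve_right A.gamma_one_ne_zero, zero_smul, add_zero]
  suffices h : y = 0 from Submodule.mem_span_singleton.mpr ⟨k, (sub_eq_zero.mp h).symm⟩
  by_contra hy0
  refine hy0 (A.denseRange_gamma.eq_zero_of_inner_left ℂ fun a => ?_)
  obtain ⟨b, hb, hba⟩ := A.exists_eigenoperator hy0 hyχ a
  rw [← hba]
  by_cases hb0 : b = 0
  · rw [hb0, ← zero_smul ℂ (1 : A.algebra), gamma_smul, zero_smul, inner_zero_right]
  · obtain ⟨c, rfl⟩ := hA b ⟨hb0, χ, hb⟩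
    rw [gamma_smul, inner_smul_right, hy1, mul_zero]

/-- The compact subsystem is trivial exactly if all eigenoperators are scalar, as the von Neumann
algebra generated by scalars consists of operators commuting with all of `B(H)`. -/
theorem compactSubsystem_isTrivial_iff :
    A.compactSubsystem.IsTrivial ↔ ∀ u : A.algebra, A.IsEigenoperator u → ∃ c : ℂ, u = c • 1 := by
  constructor
  · intro h u hu
    obtain ⟨c, hc⟩ := h ⟨u, VonNeumannAlgebra.subset_generatedBy _ ⟨u, hu, rfl⟩⟩
    have hc' : (u : H →L[ℂ] H) = c • 1 := congrArg Subtype.val hc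
    exact ⟨c, Subtype.ext hc'⟩
  · rintro h ⟨a, ha⟩
    have hcenter : a ∈ Subalgebra.center ℂ (H →L[ℂ] H) := by
      rw [Subalgebra.mem_center_iff]
      intro b
      replace ha := (VonNeumannAlgebra.coe_generatedBy _).le ha
      refine ha b fun s hs => ?_
      obtain ⟨c, rfl⟩ : ∃ c : ℂ, s = c • 1 := by
        rcases hs with ⟨u, hu, rfl⟩ | ⟨u, hu, hus⟩
        · obtain ⟨c, rfl⟩ := h u hu
          exact ⟨c, rfl⟩
        · obtain ⟨c, rfl⟩ := h u hu
          refine ⟨star c, ?_⟩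
          rw [← star_star s, ← hus]
          change star (c • (1 : H →L[ℂ] H)) = _
          rw [star_smul, star_one]
      rw [smul_one_mul, mul_smul_one]
    rw [Algebra.IsCentral.center_eq_bot] at hcenter
    obtain ⟨c, rfl⟩ := Algebra.mem_bot.mp hcenter
    exact ⟨c, Subtype.ext (Algebra.algebraMap_eq_smul_one c)⟩

end WStarSystem

theorem corollary5p5 {G : Type*} [CommGroup G] {H : Type*} [NormedAddCommGroup H]
    [InnerProductSpace ℂ H] [CompleteSpace H] (A : WStarSystem G H) :
    A.IsWeaklyMixing ↔ A.compactSubsystem.IsTrivial := by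
  rw [A.compactSubsystem_isTrivial_iff, WStarSystem.IsWeaklyMixing, rank_submodule_eq_one_iff]
  have hone := A.gamma_mem_H₀ A.isEigenoperator_one
  constructor
  · rintro ⟨v, -, -, hv⟩ u hu
    obtain ⟨c, hc⟩ := Submodule.mem_span_singleton.mp (hv hone)
    obtain ⟨d, hd⟩ := Submodule.mem_span_singleton.mp (hv (A.gamma_mem_H₀ hu))
    have hc0 : c ≠ 0 := by
      rintro rfl
      exact A.gamma_one_ne_zero (by rw [← hc, zero_smul])
    refine ⟨d / c, A.gamma_injective ?_⟩
    rw [A.gamma_smul, ← hd, ← hc, smul_smul, div_mul_cancel₀ _ hc0]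
  · intro h
    refine ⟨A.gamma 1, hone, A.gamma_one_ne_zero, ?_⟩
    exact Submodule.topologicalClosure_minimal _
      (Submodule.span_le.mpr fun x hx => hx.mem_span_gamma_one A h)
      (Submodule.closed_of_finiteDimensional _)
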